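/- Let $f\in\mathbb C[x,y,z]$ be homogeneous of degree $4$ and let $C\colon f=0$ be a smooth projective plane quartic curve over $\mathbb C$ (for instance the base change of a smooth plane quartic over $\mathbb Q$), with Jacobian $J$, where $J(\mathbb C)$ is the group of divisors of degree $0$ on $C$ modulo principal divisors. Fix $P_1,P_2,P_3\in C(\mathbb C)$. A triple of points $T_1,T_2,T_3\in C(\mathbb C)$ is said to represent the class of $\sum_i T_i-\sum_i P_i$ in $J(\mathbb C)$. Given triples $Q_1,Q_2,Q_3$ and $R_1,R_2,R_3$ of points of $C(\mathbb C)$, consider the following algorithm (all intersections are counted with multiplicity, and points may coincide). 1. Pick any point $B\in C(\mathbb C)$. 2. Find a line $\ell$ and an effective divisor $A$ of degree $2$ such that $C$ intersects $\ell$ in $P_1+P_2+A$. 3. Find a cubic $c$ and an effective divisor $E$ of degree $3$ such that $C$ intersects $c$ in $\sum_i Q_i+\sum_i R_i+A+B+E$. 4. Find a conic $n$ and an effective divisor $S$ of degree $3$ such that $C$ intersects $n$ in $B+P_3+E+S$. 5. Output the points $S_1,S_2,S_3$ with $S=S_1+S_2+S_3$. Then the algorithm is correct: each step can be carried out, whatever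 choices were made in the steps before it, and for every run of the algorithm the rational function $\frac{c}{\ell n}$ on $C$ has principal divisor $$\left(\frac{c}{\ell n}\right)=\sum_i Q_i+\sum_i R_i-\sum_i P_i-\sum_i S_i ,$$ the divisor $\sum_i S_i-\sum_i P_i$ is linearly equivalent to $\left(\sum_i Q_i-\sum_i P_i\right)+\left(\sum_i R_i-\sum_i P_i\right)$, and hence, if $Q_1,Q_2,Q_3$ and $R_1,R_2,R_3$ represent $x,y\in J(\mathbb C)$, then $S_1,S_2,S_3$ represent $x+y$. -/

import Mathlib

open scoped LinearAlgebra.Projectivization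

noncomputable section

namespace PlaneQuartic

attribute [local instance] MvPolynomial.gradedAlgebra

/-- Ternary forms of degree `d` over `ℂ`. -/
abbrev Form (d : ℕ) : Submodule ℂ (MvPolynomial (Fin 3) ℂ) :=
  MvPolynomial.homogeneousSubmodule (Fin 3) ℂ d

/-- The complex projective plane. -/
abbrev Plane : Type := ℙ ℂ (Fin 3 → ℂ)

/-- The plane quartic `f = 0` is smooth: at no point of it do all partial derivatives vanish. -/
def IsSmooth (f : Form 4) : Prop :=
  ∀ v : Fin 3 → ℂ, v ≠ 0 → MvPolynomial.eval v f.1 = 0 →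
    ∃ i, MvPolynomial.eval v (MvPolynomial.pderiv i f.1) ≠ 0

/-- The set `C(ℂ)` of complex points of the plane curve `C : f = 0`. -/
def Point (f : Form 4) : Type :=
  {P : Plane // MvPolynomial.eval P.rep f.1 = 0}

/-! ### Local rings and intersection multiplicities -/

/-- The homogeneous prime ideal of a point `P` of the plane: the polynomials that vanish
identically on the line in `ℂ³` corresponding to `P`. -/
def pointIdeal (P : Plane) : Ideal (MvPolynomial (Fin 3) ℂ) :=
  RingHom.ker (MvPolynomial.aeval
    (fun i => Polynomial.C (P.rep i) * Polynomial.X) :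
      MvPolynomial (Fin 3) ℂ →ₐ[ℂ] Polynomial ℂ)

instance pointIdeal_isPrime (P : Plane) : (pointIdeal P).IsPrime :=
  RingHom.ker_isPrime _

/-- The local ring of the projective plane at `P`: fractions `g / h` of forms of the same degree
with `h` not vanishing at `P`. -/
abbrev PlaneLocalRing (P : Plane) : Type :=
  HomogeneousLocalization.AtPrime (MvPolynomial.homogeneousSubmodule (Fin 3) ℂ) (pointIdeal P)

/-- The index of a coordinate that does not vanish at `P`. -/
def chart (P : Plane) : Fin 3 :=
  Classical.choose (Function.ne_iff.mp P.rep_nonzero)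

theorem chart_spec (P : Plane) : P.rep (chart P) ≠ 0 :=
  Classical.choose_spec (Function.ne_iff.mp P.rep_nonzero)

theorem X_chart_pow_mem (P : Plane) (d : ℕ) :
    (MvPolynomial.X (chart P) ^ d : MvPolynomial (Fin 3) ℂ) ∈ (pointIdeal P).primeCompl := by
  intro h
  have h1 := (pointIdeal_isPrime P).mem_of_pow_mem d h
  simp only [pointIdeal, RingHom.mem_ker, MvPolynomial.aeval_X, mul_eq_zero,
    Polynomial.C_eq_zero, Polynomial.X_ne_zero, or_false] at h1
  exact chart_spec P h1

theorem X_chart_pow_form (P : Plane) (d : ℕ) :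
    (MvPolynomial.X (chart P) ^ d : MvPolynomial (Fin 3) ℂ) ∈ Form d := by
  simpa using (MvPolynomial.isHomogeneous_X ℂ (chart P)).pow d

/-- The local equation `g / x_i ^ d` at `P` of a form `g` of degree `d`, where `x_i` is a
coordinate that does not vanish at `P`. -/
def germ {d : ℕ} (g : Form d) (P : Plane) : PlaneLocalRing P :=
  HomogeneousLocalization.mk
    { deg := d
      num := g
      den := ⟨MvPolynomial.X (chart P) ^ d, X_chart_pow_form P d⟩
      den_mem := X_chart_pow_mem P d }

/-- The local ring `𝒪_{C,P}` of the curve `C : f = 0` at its point `P`. -/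
abbrev CurveLocalRing (f : Form 4) (P : Point f) : Type :=
  PlaneLocalRing P.1 ⧸ Ideal.span {germ f P.1}

/-- The intersection multiplicity at `P` of `C : f = 0` with the curve `g = 0`, that is, the order
of vanishing at `P` of the form `g` on `C`: the length of `𝒪_{C,P} / (g)`. -/
def mult (f : Form 4) {d : ℕ} (g : Form d) (P : Point f) : ℕ∞ :=
  Ring.ord (CurveLocalRing f P) (Ideal.Quotient.mk _ (germ g P.1))

/-! ### Divisors -/

/-- Divisors on `C`. -/
abbrev Divisor (f : Form 4) : Type := Point f →₀ ℤ

/-- A point of `C`, as a divisor. -/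
abbrev pt {f : Form 4} (P : Point f) : Divisor f := Finsupp.single P 1

/-- The divisor `T₁ + T₂ + T₃` of a triple of points. -/
def tripleSum {f : Form 4} (T : Fin 3 → Point f) : Divisor f := ∑ i, pt (T i)

/-- The degree of a divisor. -/
abbrev degree {f : Form 4} : Divisor f →+ ℤ := Finsupp.degree

/-- `C` intersects the curve `g = 0` in the divisor `D`: the curves have no common component and
the multiplicity of each point in `D` is the intersection multiplicity there. -/
def IntersectsIn {f : Form 4} {d : ℕ} (g : Form d) (D : Divisor f) : Prop :=
  ∀ P : Point f, ∃ m : ℕ, mult f g P = m ∧ D P = m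

/-! ### Rational functions and linear equivalence -/

/-- The homogeneous coordinate ring of `C`. -/
abbrev CoordRing (f : Form 4) : Type :=
  MvPolynomial (Fin 3) ℂ ⧸ Ideal.span {f.1}

/-- The ring of fractions of the homogeneous coordinate ring. The function field of `C` consists
of the elements of it that are quotients of two forms of the same degree. -/
abbrev Fractions (f : Form 4) : Type := FractionRing (CoordRing f)

/-- A polynomial as an element of the ring of fractions. -/
def toFractions (f : Form 4) (g : MvPolynomial (Fin 3) ℂ) : Fractions f :=
  algebraMap (CoordRing f) (Fractions f) (Ideal.Quotient.mk _ g)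

/-- `φ = g / h` on `C`, where `h` does not vanish identically on `C`. -/
def IsQuotient {f : Form 4} (φ : Fractions f) (g h : MvPolynomial (Fin 3) ℂ) : Prop :=
  h ∉ Ideal.span {f.1} ∧ φ * toFractions f h = toFractions f g

/-- `φ` is a nonzero rational function on `C` whose principal divisor is `D`: at each point `P` the
multiplicity of `D` is `ord_P g - ord_P h`, where `φ = g / h` with forms `g`, `h` of the same
degree that do not vanish identically on `C`. -/
def HasDivisor {f : Form 4} (φ : Fractions f) (D : Divisor f) : Prop :=
  ∀ P : Point f, ∃ (d : ℕ) (g h : Form d) (a b : ℕ),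
    IsQuotient φ g.1 h.1 ∧ mult f g P = a ∧ mult f h P = b ∧ D P = (a : ℤ) - b

/-- Linear equivalence of divisors. -/
def LinearlyEquivalent {f : Form 4} (D D' : Divisor f) : Prop :=
  ∃ φ : Fractions f, HasDivisor φ (D - D')

/-- The group of divisors of degree zero. -/
def degreeZero (f : Form 4) : AddSubgroup (Divisor f) := (degree (f := f)).ker

/-- The group of principal divisors (which form a subgroup if `C` is smooth, so that the closure
adds nothing). -/
def principalDivisors (f : Form 4) : AddSubgroup (Divisor f) :=
  AddSubgroup.closure {D | ∃ φ : Fractions f, HasDivisor φ D}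

/-- The group `J(ℂ)` of complex points of the Jacobian of `C`: divisors of degree zero modulo
principal divisors. -/
abbrev Jacobian (f : Form 4) : Type :=
  degreeZero f ⧸ (principalDivisors f).addSubgroupOf (degreeZero f)

theorem tripleSum_sub_mem {f : Form 4} (P T : Fin 3 → Point f) :
    tripleSum T - tripleSum P ∈ degreeZero f := by
  simp [degreeZero, tripleSum, AddMonoidHom.mem_ker]

/-- The triple `T` represents the point `T₁ + T₂ + T₃ - P₁ - P₂ - P₃` of the Jacobian. -/
def Represents {f : Form 4} (P T : Fin 3 → Point f) (x : Jacobian f) : Prop :=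
  QuotientAddGroup.mk (⟨tripleSum T - tripleSum P, tripleSum_sub_mem P T⟩ : degreeZero f) = x

/-! ### The steps of the addition algorithm

The auxiliary point `B` of the first step is arbitrary. "Through" is understood with
multiplicities, and any line, cubic and conic with the required property may be chosen.
The indices `1, 2, 3` of the triples are `0, 1, 2` here. -/

/-- Second step: `ℓ` is a line through `P₁` and `P₂`, and the effective divisor `A` of degree 2 is
the residual intersection. -/
def StepLine {f : Form 4} (P : Fin 3 → Point f) (l : Form 1) (A : Divisor f) : Prop :=
  l ≠ 0 ∧ 0 ≤ A ∧ degree A = 2 ∧ IntersectsIn l (pt (P 0) + pt (P 1) + A)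

/-- Third step: `c` is a cubic through `Q₁, Q₂, Q₃, R₁, R₂, R₃, A, B`, and the effective divisor
`E` of degree 3 is the residual intersection. -/
def StepCubic {f : Form 4} (Q R : Fin 3 → Point f) (A : Divisor f) (B : Point f)
    (c : Form 3) (E : Divisor f) : Prop :=
  c ≠ 0 ∧ 0 ≤ E ∧ degree E = 3 ∧ IntersectsIn c (tripleSum Q + tripleSum R + A + pt B + E)

/-- Fourth step: `n` is a conic through `B, P₃, E`, and the effective divisor `S` of degree 3 is
the residual intersection. -/
def StepConic {f : Form 4} (P : Fin 3 → Point f) (B : Point f) (E : Divisor f)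
    (n : Form 2) (S : Divisor f) : Prop :=
  n ≠ 0 ∧ 0 ≤ S ∧ degree S = 3 ∧ IntersectsIn n (pt B + pt (P 2) + E + S)

/-- Fifth step: the output `T` is the triple of points of which `S` consists. -/
def StepOutput {f : Form 4} (S : Divisor f) (T : Fin 3 → Point f) : Prop :=
  tripleSum T = S

end PlaneQuartic

end

noncomputable section

namespace PlaneQuartic

open MvPolynomial

attribute [local instance] MvPolynomial.gradedAlgebra

/-!
The three curves exist by a dimension count: each point of a divisor imposes at most one linear
condition on the forms of a given degree, and `2 < 3`, `9 < 10`, `5 < 6`. That the residual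
intersection has the right degree is Bézout's theorem for the smooth quartic `C : f = 0` and a form
`g` of degree `d` without the factor `f`. Once it is known, the points of `A`, `B` and `E` cancel
in `div c - div l - div n`, and what is left is the claimed divisor.

For Bézout's theorem, the forms of degree `n` in the ideal `(f, g)` have codimension exactly `4d`
for large `n`, by the Koszul relation between `f` and `g`. The forms whose divisor is at least an
effective divisor `s` have codimension `deg s` for large `n`. If `s ≤ div g`, the former space is
contained in the latter, so `deg s ≤ 4d`. If `s = div g`, the two spaces agree for large `n`: the
local rings of `C` are discrete valuation rings, so a form with divisor at least `div g` lies in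
`(f, g)` locally at every point, and by the Nullstellensatz this suffices in large degrees.
-/

/-! ### Homogeneous polynomials -/

section Homogeneous

variable {σ R : Type*} [CommRing R] {d : ℕ} {g : MvPolynomial σ R}

theorem homogeneousComponent_mul (hg : g.IsHomogeneous d) (h : MvPolynomial σ R) (e : ℕ) :
    homogeneousComponent (d + e) (g * h) = g * homogeneousComponent e h := by
  have key := DirectSum.coe_decompose_mul_add_of_left_mem (homogeneousSubmodule σ R)
    (i := d) (j := e) (b := h) hg
  exact (decomposition.decompose'_apply (g * h) (d + e)).symm.trans
    (key.trans (congrArg (g * ·) (decomposition.decompose'_apply h e)))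

theorem aeval_mul_right {A : Type*} [CommRing A] [Algebra R A] (hg : g.IsHomogeneous d)
    (v : σ → A) (t : A) : aeval (fun i => v i * t) g = aeval v g * t ^ d := by
  simp only [aeval_def, eval₂_eq, Finset.sum_mul]
  refine Finset.sum_congr rfl fun m hm => ?_
  have hm : ∑ i ∈ m.support, m i = d := (hg.degree_eq_sum_deg_support hm).symm
  simp only [mul_pow, Finset.prod_mul_distrib, Finset.prod_pow_eq_pow_sum, hm, mul_assoc]

theorem eval_smul_of_isHomogeneous (hg : g.IsHomogeneous d) (t : R) (v : σ → R) :
    eval (t • v) g = t ^ d * eval v g := by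
  have h := aeval_mul_right hg v t
  rw [aeval_eq_eval, aeval_eq_eval] at h
  simpa only [Pi.smul_def, smul_eq_mul, mul_comm _ t, mul_comm _ (t ^ d)] using h

theorem eval_zero_of_isHomogeneous (hg : g.IsHomogeneous d) (hd : d ≠ 0) : eval 0 g = 0 := by
  simpa [zero_pow hd] using eval_smul_of_isHomogeneous hg 0 0

theorem aeval_sub_aeval_mem {A : Type*} [CommRing A] [Algebra R A] {I : Ideal A} {a b : σ → A}
    (hab : ∀ i, a i - b i ∈ I) (p : MvPolynomial σ R) : aeval a p - aeval b p ∈ I := by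
  have hmk : Ideal.Quotient.mkₐ R I ∘ a = Ideal.Quotient.mkₐ R I ∘ b :=
    funext fun i => Ideal.Quotient.eq.mpr (hab i)
  have haeval (c : σ → A) : Ideal.Quotient.mkₐ R I (aeval c p)
      = aeval (Ideal.Quotient.mkₐ R I ∘ c) p := comp_aeval_apply _ _ _
  exact Ideal.Quotient.eq.mp ((haeval a).trans ((congrArg (aeval · p) hmk).trans (haeval b).symm))

theorem mem_span_of_eval_eq_zero {v : σ → R} {i : σ} (hi : IsUnit (v i)) (hg : g.IsHomogeneous d)
    (hv : eval v g = 0) :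
    g ∈ Ideal.span (Set.range fun j => C (v i) * X j - C (v j) * X i) := by
  have hmem := aeval_sub_aeval_mem
    (I := Ideal.span (Set.range fun j => C (v i) * X j - C (v j) * X i))
    (a := fun j => X j * C (v i)) (b := fun j => C (v j) * X i)
    (fun j => Ideal.subset_span ⟨j, by rw [mul_comm (X j)]⟩) g
  have hC : aeval (fun j => (C (v j) : MvPolynomial σ R)) g = C (eval v g) := by
    simpa [aeval_eq_eval, Function.comp_def] using
      aeval_algebraMap_apply (B := MvPolynomial σ R) v g
  rw [aeval_mul_right hg, aeval_mul_right hg, hC, hv, C_0, zero_mul, sub_zero,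
    aeval_X_left_apply] at hmem
  exact (Ideal.mul_unit_mem_iff_mem _ ((hi.map C).pow d)).mp hmem

/-- The polynomial `g(x T)` in a new variable `T`, whose coefficients are the homogeneous
components of `g`. -/
def degreeExpansion : MvPolynomial σ R →ₐ[R] Polynomial (MvPolynomial σ R) :=
  aeval fun i => Polynomial.C (X i) * Polynomial.X

theorem degreeExpansion_of_isHomogeneous (hg : g.IsHomogeneous d) :
    degreeExpansion g = Polynomial.C g * Polynomial.X ^ d := by
  have hC : aeval (fun i => Polynomial.C (X i : MvPolynomial σ R)) g = Polynomial.C g := by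
    simpa [Function.comp_def] using
      aeval_algebraMap_apply (B := Polynomial (MvPolynomial σ R)) (X : σ → MvPolynomial σ R) g
  rw [degreeExpansion, aeval_mul_right hg, hC]

theorem coeff_degreeExpansion (h : MvPolynomial σ R) (k : ℕ) :
    (degreeExpansion h).coeff k = homogeneousComponent k h := by
  conv_lhs => rw [← sum_homogeneousComponent h]
  simp only [map_sum, Polynomial.finsetSum_coeff,
    degreeExpansion_of_isHomogeneous (homogeneousComponent_isHomogeneous _ h),
    Polynomial.coeff_C_mul_X_pow, Finset.sum_ite_eq, Finset.mem_range, ite_eq_left_iff, not_lt]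
  exact fun hk => (homogeneousComponent_eq_zero k h hk).symm

theorem exists_isHomogeneous_of_dvd [IsDomain R] {h : MvPolynomial σ R} (hg : g.IsHomogeneous d)
    (hg0 : g ≠ 0) (hdvd : h ∣ g) : ∃ e, h.IsHomogeneous e := by
  obtain ⟨k, rfl⟩ := hdvd
  have hexp := degreeExpansion_of_isHomogeneous hg
  rw [map_mul] at hexp
  have hne : degreeExpansion h * degreeExpansion k ≠ 0 := by
    rw [hexp]
    exact mul_ne_zero (Polynomial.C_ne_zero.mpr hg0) (pow_ne_zero _ Polynomial.X_ne_zero)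
  have hh := left_ne_zero_of_mul hne
  have hk := right_ne_zero_of_mul hne
  have htop := Polynomial.natDegree_mul hh hk
  have hbot := Polynomial.natTrailingDegree_mul hh hk
  rw [hexp, Polynomial.natDegree_C_mul_X_pow _ _ hg0] at htop
  rw [hexp, Polynomial.C_mul_X_pow_eq_monomial, Polynomial.natTrailingDegree_monomial hg0] at hbot
  have hh_le := (degreeExpansion h).natTrailingDegree_le_natDegree
  have hk_le := (degreeExpansion k).natTrailingDegree_le_natDegree
  refine ⟨(degreeExpansion h).natDegree, ?_⟩
  suffices hsum : ∑ i ∈ Finset.range (h.totalDegree + 1), homogeneousComponent i h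
      ∈ homogeneousSubmodule σ R (degreeExpansion h).natDegree by
    rwa [sum_homogeneousComponent] at hsum
  refine Submodule.sum_mem _ fun i _ => ?_
  obtain rfl | hi := eq_or_ne i (degreeExpansion h).natDegree
  · exact homogeneousComponent_isHomogeneous _ h
  · have hzero : (degreeExpansion h).coeff i = 0 := by
      rcases hi.lt_or_gt with hi | hi
      · exact Polynomial.coeff_eq_zero_of_lt_natTrailingDegree (by lia)
      · exact Polynomial.coeff_eq_zero_of_natDegree_lt hi
    rw [← coeff_degreeExpansion, hzero]
    exact Submodule.zero_mem _

theorem eq_zero_of_isHomogeneous_of_dvd [IsDomain R] {h : MvPolynomial σ R} {e : ℕ}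
    (hg : g.IsHomogeneous d) (hh : h.IsHomogeneous e) (hed : e < d) (hdvd : g ∣ h) : h = 0 := by
  by_contra h0
  have hle := totalDegree_le_of_dvd_of_isDomain hdvd h0
  rw [hg.totalDegree (ne_zero_of_dvd_ne_zero h0 hdvd), hh.totalDegree h0] at hle
  lia

theorem finrank_homogeneousSubmodule [Fintype σ] [StrongRankCondition R] (d : ℕ) :
    Module.finrank R (homogeneousSubmodule σ R d) = (Fintype.card σ + d - 1).choose d := by
  classical
  have hdeg : {m : σ →₀ ℕ | m.degree = d}
      = ((Finset.univ : Finset σ).finsuppAntidiag d : Set (σ →₀ ℕ)) := by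
    ext m
    simp [Finset.mem_finsuppAntidiag, Finsupp.degree_eq_sum]
  rw [homogeneousSubmodule_eq_finsupp_supported, AddMonoidAlgebra.supported_eq_map,
    LinearEquiv.finrank_map_eq, hdeg, (Finsupp.supportedEquivFinsupp _).finrank_eq,
    Module.finrank_finsupp_self, ← Nat.card_eq_fintype_card, Nat.card_coe_set_eq,
    Set.ncard_coe_finset, Finset.card_finsuppAntidiag_nat_eq_choose, Finset.card_univ]

theorem isHomogeneous_mem_span_X_pow (hg : g.IsHomogeneous d) :
    g ∈ Ideal.span (Set.range (X : σ → MvPolynomial σ R)) ^ d :=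
  (Ideal.mem_span_pow_iff_exists_isHomogeneous X g).mpr
    ⟨map C g, hg.map C, by rw [eval_map, eval₂_eta]⟩

end Homogeneous

section Nullstellensatz

variable {σ K : Type*} [Finite σ] [Field K]

theorem exists_forall_isHomogeneous_mem [IsAlgClosed K] {I : Ideal (MvPolynomial σ K)}
    (hI : zeroLocus K I ⊆ {0}) :
    ∃ N, ∀ n ≥ N, ∀ g : MvPolynomial σ K, g.IsHomogeneous n → g ∈ I := by
  have hrad : Ideal.span (Set.range (X : σ → MvPolynomial σ K)) ≤ I.radical := by
    rw [← vanishingIdeal_zeroLocus_eq_radical (K := K), Ideal.span_le]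
    rintro _ ⟨i, rfl⟩
    refine mem_vanishingIdeal_iff.mpr fun v hv => ?_
    rw [Set.mem_singleton_iff.mp (hI hv), aeval_X, Pi.zero_apply]
  obtain ⟨N, hN⟩ := Ideal.exists_pow_le_of_le_radical_of_fg hrad (IsNoetherian.noetherian _)
  exact ⟨N, fun n hn g hg => hN (Ideal.pow_le_pow_right hn (isHomogeneous_mem_span_X_pow hg))⟩

end Nullstellensatz

/-! ### Pairs of plane curves -/

section Forms

variable {a b n : ℕ}

instance (d : ℕ) : Module.Finite ℂ (Form d) :=
  Module.Finite.iff_fg.mpr (homogeneousSubmodule_fg (Fin 3) ℂ d)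

theorem finrank_form (d : ℕ) : Module.finrank ℂ (Form d) = (d + 2).choose 2 := by
  rw [finrank_homogeneousSubmodule, Fintype.card_fin, show 3 + d - 1 = d + 2 by lia,
    Nat.choose_symm_add]

theorem two_mul_finrank_form (d : ℕ) : 2 * Module.finrank ℂ (Form d) = (d + 2) * (d + 1) := by
  rw [finrank_form, mul_comm, Nat.choose_two_right, Nat.div_two_mul_two_of_even
    (Nat.even_mul_pred_self _), Nat.add_succ_sub_one]

/-- Multiplication by a form, with the degree of the product as a free parameter, so that
associativity of addition in degrees never gets in the way. -/
def mulForm (g : Form a) (hn : a + b = n) : Form b →ₗ[ℂ] Form n :=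
  (LinearMap.mulLeft ℂ g.1).restrict fun _ hk => hn ▸ IsHomogeneous.mul g.2 hk

@[simp]
theorem coe_mulForm (g : Form a) (hn : a + b = n) (h : Form b) :
    (mulForm g hn h).1 = g.1 * h.1 := rfl

theorem exists_eq_mulForm (g : Form a) (hn : a + b = n) {h : Form n} (hdvd : g.1 ∣ h.1) :
    ∃ k, h = mulForm g hn k := by
  subst hn
  obtain ⟨k, hk⟩ := hdvd
  refine ⟨⟨homogeneousComponent b k, homogeneousComponent_mem b k⟩, Subtype.ext ?_⟩
  rw [coe_mulForm, ← homogeneousComponent_mul g.2, ← hk, homogeneousComponent_eq_self h.2]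

/-- The linear combinations `u g + w h` of degree `a + b + e` of two forms `g` and `h` of degrees
`a` and `b`, as a function of the coefficients `(u, w)`. -/
def combinations (g : Form a) (h : Form b) (e : ℕ) :
    Form (b + e) × Form (a + e) →ₗ[ℂ] Form (a + b + e) :=
  (mulForm g (by lia)).coprod (mulForm h (by lia))

theorem coe_combinations (g : Form a) (h : Form b) (e : ℕ) (u : Form (b + e) × Form (a + e)) :
    (combinations g h e u).1 = g.1 * u.1.1 + h.1 * u.2.1 := rfl

theorem mem_range_combinations {g : Form a} {h : Form b} {e : ℕ} {k : Form (a + b + e)}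
    (hk : k.1 ∈ Ideal.span {g.1, h.1}) : k ∈ LinearMap.range (combinations g h e) := by
  obtain ⟨u, w, huw⟩ := Ideal.mem_span_pair.mp hk
  refine ⟨(⟨_, homogeneousComponent_mem (b + e) u⟩, ⟨_, homogeneousComponent_mem (a + e) w⟩),
    Subtype.ext ?_⟩
  have hu := homogeneousComponent_mul g.2 u (b + e)
  have hw := homogeneousComponent_mul h.2 w (a + e)
  rw [← add_assoc] at hu
  rw [← add_assoc, add_comm b a] at hw
  rw [coe_combinations, ← hu, ← hw, ← map_add, mul_comm g.1, mul_comm h.1, huw,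
    homogeneousComponent_eq_self k.2]

/-- The trivial relation `(k h) g + (- k g) h = 0` between two forms `g` and `h`, as a function
of `k`. -/
def koszul (g : Form a) (h : Form b) (e : ℕ) : Form e →ₗ[ℂ] Form (b + e) × Form (a + e) :=
  (mulForm h rfl).prod (-mulForm g rfl)

theorem range_koszul_le_ker (g : Form a) (h : Form b) (e : ℕ) :
    LinearMap.range (koszul g h e) ≤ LinearMap.ker (combinations g h e) := by
  rintro _ ⟨k, rfl⟩
  refine Subtype.ext ?_
  change g.1 * (h.1 * k.1) + h.1 * -(g.1 * k.1) = 0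
  ring

theorem koszul_injective {g : Form a} {h : Form b} (hgh : g ≠ 0 ∨ h ≠ 0) (e : ℕ) :
    Function.Injective (koszul g h e) := by
  refine (injective_iff_map_eq_zero _).mpr fun k hk => ?_
  obtain ⟨hk₁, hk₂⟩ := Prod.ext_iff.mp hk
  have hk₁ : h.1 * k.1 = 0 := congrArg Subtype.val hk₁
  have hk₂ : -(g.1 * k.1) = 0 := congrArg Subtype.val hk₂
  refine Subtype.ext ?_
  rcases hgh with hg | hh
  · exact (mul_eq_zero.mp (neg_eq_zero.mp hk₂)).resolve_left fun h0 => hg (Subtype.ext h0)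
  · exact (mul_eq_zero.mp hk₁).resolve_left fun h0 => hh (Subtype.ext h0)

theorem ker_combinations_le {g : Form a} {h : Form b} (hg : Prime g.1) (hgh : ¬ g.1 ∣ h.1)
    (e : ℕ) : LinearMap.ker (combinations g h e) ≤ LinearMap.range (koszul g h e) := by
  rintro ⟨u, w⟩ huw
  have huw : g.1 * u.1 + h.1 * w.1 = 0 := congrArg Subtype.val huw
  have hdvd : g.1 ∣ h.1 * w.1 := ⟨-u.1, by linear_combination huw⟩
  obtain ⟨k, rfl⟩ := exists_eq_mulForm g rfl ((hg.dvd_or_dvd hdvd).resolve_left hgh)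
  refine ⟨-k, Prod.ext (Subtype.ext (mul_left_cancel₀ hg.ne_zero ?_)) ?_⟩
  · change g.1 * (h.1 * -k.1) = g.1 * u.1
    rw [coe_mulForm] at huw
    linear_combination -huw
  · exact (congrArg Neg.neg (map_neg _ k)).trans (neg_neg _)

theorem finrank_form_add (a b e : ℕ) :
    Module.finrank ℂ (Form (b + e)) + Module.finrank ℂ (Form (a + e)) + a * b
      = Module.finrank ℂ (Form (a + b + e)) + Module.finrank ℂ (Form e) := by
  nlinarith [two_mul_finrank_form e, two_mul_finrank_form (b + e), two_mul_finrank_form (a + e),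
    two_mul_finrank_form (a + b + e)]

theorem finrank_range_add_finrank_ker_combinations (g : Form a) (h : Form b) (e : ℕ) :
    Module.finrank ℂ (LinearMap.range (combinations g h e))
        + Module.finrank ℂ (LinearMap.ker (combinations g h e)) + a * b
      = Module.finrank ℂ (Form (a + b + e)) + Module.finrank ℂ (Form e) := by
  rw [LinearMap.finrank_range_add_finrank_ker, Module.finrank_prod, finrank_form_add]

theorem finrank_range_combinations_add_le {g : Form a} {h : Form b} (hgh : g ≠ 0 ∨ h ≠ 0)
    (e : ℕ) :
    Module.finrank ℂ (LinearMap.range (combinations g h e)) + a * b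
      ≤ Module.finrank ℂ (Form (a + b + e)) := by
  have hker := Submodule.finrank_mono (range_koszul_le_ker g h e)
  rw [LinearMap.finrank_range_of_inj (koszul_injective hgh e)] at hker
  linarith [finrank_range_add_finrank_ker_combinations g h e]

theorem finrank_form_le_range_combinations_add {g : Form a} {h : Form b} (hg : Prime g.1)
    (hgh : ¬ g.1 ∣ h.1) (e : ℕ) :
    Module.finrank ℂ (Form (a + b + e))
      ≤ Module.finrank ℂ (LinearMap.range (combinations g h e)) + a * b := by
  have hker := (Submodule.finrank_mono (ker_combinations_le hg hgh e)).trans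
    (LinearMap.finrank_range_le _)
  linarith [finrank_range_add_finrank_ker_combinations g h e]

theorem exists_common_zero (g : Form a) (h : Form b) (ha : a ≠ 0) (hb : b ≠ 0) :
    ∃ v ≠ 0, eval v g.1 = 0 ∧ eval v h.1 = 0 := by
  by_cases hgh : g = 0 ∧ h = 0
  · exact ⟨1, one_ne_zero, by simp [hgh.1], by simp [hgh.2]⟩
  by_contra! hv
  have hlocus : zeroLocus ℂ (Ideal.span {g.1, h.1}) ⊆ {0} := fun v hmem => by
    simp only [zeroLocus_span, Set.mem_insert_iff, forall_eq_or_imp, Set.mem_singleton_iff,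
      forall_eq, Set.mem_ofPred_eq, aeval_eq_eval] at hmem
    exact by_contra fun h0 => hv v h0 hmem.1 hmem.2
  obtain ⟨N, hN⟩ := exists_forall_isHomogeneous_mem hlocus
  have hsurj : LinearMap.range (combinations g h N) = ⊤ :=
    top_unique fun k _ => mem_range_combinations (hN _ (by lia) k.1 k.2)
  have hle := finrank_range_combinations_add_le (not_and_or.mp hgh) N
  rw [hsurj, finrank_top] at hle
  have hab := Nat.mul_pos (Nat.pos_of_ne_zero ha) (Nat.pos_of_ne_zero hb)
  lia

end Forms

section Smooth

variable {f : Form 4}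

theorem IsSmooth.ne_zero (hf : IsSmooth f) : f.1 ≠ 0 := fun h => by
  obtain ⟨i, hi⟩ := hf 1 one_ne_zero (by rw [h, map_zero])
  rw [h, map_zero, map_zero] at hi
  exact hi rfl

theorem IsSmooth.prime (hf : IsSmooth f) : Prime f.1 := by
  have isUnit_of_degree_zero {p : MvPolynomial (Fin 3) ℂ} (hp : p ∣ f.1)
      (hp0 : p.IsHomogeneous 0) : IsUnit p := by
    rw [← totalDegree_zero_iff_isHomogeneous, totalDegree_eq_zero_iff_eq_C] at hp0
    have hc : coeff 0 p ≠ 0 := fun hc =>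
      ne_zero_of_dvd_ne_zero hf.ne_zero hp (by rw [hp0, hc, C_0])
    exact hp0 ▸ hc.isUnit.map C
  refine Irreducible.prime ⟨fun hu => ?_, fun g h hgh => ?_⟩
  · exact (hu.map (eval 0)).ne_zero (eval_zero_of_isHomogeneous f.2 four_ne_zero)
  by_contra! hunit
  have hg := Dvd.intro h hgh.symm
  have hh := Dvd.intro_left g hgh.symm
  obtain ⟨a, hga⟩ := exists_isHomogeneous_of_dvd f.2 hf.ne_zero hg
  obtain ⟨b, hhb⟩ := exists_isHomogeneous_of_dvd f.2 hf.ne_zero hh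
  obtain ⟨v, hv, hgv, hhv⟩ := exists_common_zero ⟨g, hga⟩ ⟨h, hhb⟩
    (fun ha => hunit.1 (isUnit_of_degree_zero hg (ha ▸ hga)))
    (fun hb => hunit.2 (isUnit_of_degree_zero hh (hb ▸ hhb)))
  obtain ⟨i, hi⟩ := hf v hv (by rw [hgh, map_mul, hgv, zero_mul])
  exact hi (by simp [hgh, Derivation.leibniz, hgv, hhv])

end Smooth

/-! ### Orders of vanishing in a local ring with principal maximal ideal -/

section Order

variable {R : Type*} [CommRing R]

theorem ord_eq_zero_iff {r : R} : Ring.ord R r = 0 ↔ IsUnit r := by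
  rw [Ring.ord, Module.length_eq_zero_iff, Ideal.Quotient.subsingleton_iff,
    Ideal.span_singleton_eq_top]

variable [IsLocalRing R] {τ : R}

theorem ord_eq_one_of_maximalIdeal_eq_span (hτ : IsLocalRing.maximalIdeal R = Ideal.span {τ}) :
    Ring.ord R τ = 1 := by
  rw [Ring.ord, Module.length_eq_one_iff, isSimpleModule_iff_isCoatom, ← hτ]
  exact (IsLocalRing.maximalIdeal.isMaximal R).out

variable [IsDomain R] {k : ℕ} {r s : R}

theorem natCast_le_ord_iff (hτ : IsLocalRing.maximalIdeal R = Ideal.span {τ}) (hτ0 : τ ≠ 0) :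
    (k : ℕ∞) ≤ Ring.ord R r ↔ τ ^ k ∣ r := by
  have hord (r : R) : Ring.ord R (τ * r) = 1 + Ring.ord R r := by
    rw [Ring.ord_mul' R (mem_nonZeroDivisors_of_ne_zero hτ0), ord_eq_one_of_maximalIdeal_eq_span hτ]
  induction k generalizing r with
  | zero => simp
  | succ k ih =>
    rw [Nat.cast_succ, add_comm, pow_succ']
    constructor
    · intro hk
      have hr : r ∈ IsLocalRing.maximalIdeal R := fun hu => by
        rw [ord_eq_zero_iff.mpr hu, nonpos_iff_eq_zero, add_eq_zero] at hk
        exact one_ne_zero hk.1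
      rw [hτ, Ideal.mem_span_singleton] at hr
      obtain ⟨s, rfl⟩ := hr
      rw [hord, ENat.add_le_add_iff_left ENat.one_ne_top] at hk
      exact mul_dvd_mul_left τ (ih.mp hk)
    · rintro ⟨s, rfl⟩
      rw [mul_assoc, hord]
      exact add_le_add_right (ih.mpr (dvd_mul_right _ _)) 1

theorem ord_zero_eq_top (hτ : IsLocalRing.maximalIdeal R = Ideal.span {τ}) (hτ0 : τ ≠ 0) :
    Ring.ord R (0 : R) = ⊤ :=
  ENat.eq_top_iff_forall_ge.mpr fun _ => (natCast_le_ord_iff hτ hτ0).mpr (dvd_zero _)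

theorem associated_pow_of_ord_eq (hτ : IsLocalRing.maximalIdeal R = Ideal.span {τ}) (hτ0 : τ ≠ 0)
    (hr : Ring.ord R r = k) : Associated (τ ^ k) r := by
  obtain ⟨u, rfl⟩ := (natCast_le_ord_iff hτ hτ0).mp hr.ge
  rw [Ring.ord_mul' R (pow_mem (mem_nonZeroDivisors_of_ne_zero hτ0) k),
    Ring.ord_pow (mem_nonZeroDivisors_of_ne_zero hτ0), ord_eq_one_of_maximalIdeal_eq_span hτ,
    nsmul_one] at hr
  have hu : Ring.ord R u = 0 :=
    ENat.add_right_injective_of_ne_top (ENat.natCast_ne_top k) (hr.trans (add_zero _).symm)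
  exact associated_mul_unit_right _ _ (ord_eq_zero_iff.mp hu)

theorem dvd_of_ord_le (hτ : IsLocalRing.maximalIdeal R = Ideal.span {τ}) (hτ0 : τ ≠ 0)
    (hr : Ring.ord R r ≠ ⊤) (hrs : Ring.ord R r ≤ Ring.ord R s) : r ∣ s := by
  obtain ⟨k, hk⟩ := ENat.ne_top_iff_exists.mp hr
  exact (associated_pow_of_ord_eq hτ hτ0 hk.symm).symm.dvd.trans
    ((natCast_le_ord_iff hτ hτ0).mp (hk.trans_le hrs))

end Order

/-! ### Germs of forms -/

section PlaneGerm

variable {P : Plane} {d e n : ℕ}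

theorem mem_pointIdeal_iff {g : MvPolynomial (Fin 3) ℂ} (hg : g.IsHomogeneous d) :
    g ∈ pointIdeal P ↔ eval P.rep g = 0 := by
  have hC : aeval (fun i => Polynomial.C (P.rep i)) g = Polynomial.C (eval P.rep g) := by
    simpa [aeval_eq_eval, Function.comp_def] using
      aeval_algebraMap_apply (B := Polynomial ℂ) P.rep g
  change aeval (fun i => Polynomial.C (P.rep i) * Polynomial.X) g = 0 ↔ _
  rw [aeval_mul_right hg, hC]
  simp

theorem val_germ_mul (g : Form d) (P : Plane) :
    (germ g P).val * algebraMap _ _ (X (chart P) ^ d : MvPolynomial (Fin 3) ℂ)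
      = algebraMap (MvPolynomial (Fin 3) ℂ) (Localization.AtPrime (pointIdeal P)) g.1 := by
  rw [germ, HomogeneousLocalization.val_mk, Localization.mk_eq_mk']
  exact IsLocalization.mk'_spec _ g.1 ⟨X (chart P) ^ d, X_chart_pow_mem P d⟩

theorem germ_add (g h : Form d) : germ (g + h) P = germ g P + germ h P := by
  rw [HomogeneousLocalization.ext_iff_val, HomogeneousLocalization.val_add]
  simp only [germ, HomogeneousLocalization.val_mk, Localization.add_mk_self]
  rfl

theorem germ_mulForm (g : Form d) (hn : d + e = n) (h : Form e) :
    germ (mulForm g hn h) P = germ g P * germ h P := by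
  subst hn
  rw [HomogeneousLocalization.ext_iff_val, HomogeneousLocalization.val_mul]
  simp only [germ, HomogeneousLocalization.val_mk, Localization.mk_mul, coe_mulForm]
  congr 1
  exact Subtype.ext (pow_add _ _ _)

theorem isUnit_germ_iff {g : Form d} : IsUnit (germ g P) ↔ eval P.rep g.1 ≠ 0 := by
  rw [← HomogeneousLocalization.isUnit_iff_isUnit_val]
  simp only [germ, HomogeneousLocalization.val_mk, Localization.mk_eq_mk']
  rw [IsLocalization.AtPrime.isUnit_mk'_iff (Localization.AtPrime (pointIdeal P)) (pointIdeal P),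
    Ideal.mem_primeCompl_iff, mem_pointIdeal_iff g.2]

theorem exists_mul_germ_eq (a : PlaneLocalRing P) :
    ∃ (d : ℕ) (g s : Form d), eval P.rep s.1 ≠ 0 ∧ a * germ s P = germ g P := by
  obtain ⟨⟨d, g, s, hs⟩, rfl⟩ := HomogeneousLocalization.mk_surjective a
  refine ⟨d, g, s, fun h => hs ((mem_pointIdeal_iff s.2).mpr h), ?_⟩
  rw [HomogeneousLocalization.ext_iff_val, HomogeneousLocalization.val_mul]
  simp only [germ, HomogeneousLocalization.val_mk, Localization.mk_mul]
  rw [Localization.mk_eq_mk_iff, Localization.r_iff_exists]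
  exact ⟨1, by simp only [Submonoid.coe_mul, OneMemClass.coe_one]; ring⟩

theorem exists_mul_mem_span_of_germ_eq {c : ℕ} {f : Form c} {g : Form d} {h : Form e}
    {a b : PlaneLocalRing P} (hab : germ h P = germ f P * b + germ g P * a) :
    ∃ (k : ℕ) (t : Form k), eval P.rep t.1 ≠ 0 ∧ t.1 * h.1 ∈ Ideal.span {f.1, g.1} := by
  obtain ⟨p, u, s, hs, hu⟩ := exists_mul_germ_eq a
  obtain ⟨q, w, s', hs', hw⟩ := exists_mul_germ_eq b
  let x : MvPolynomial (Fin 3) ℂ := X (chart P)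
  have cleared : (w.1 * s.1 * x ^ (d + e)) * f.1 + (u.1 * s'.1 * x ^ (c + e)) * g.1
      = s.1 * s'.1 * x ^ (c + d) * h.1 := by
    apply IsLocalization.injective (Localization.AtPrime (pointIdeal P))
      (Ideal.primeCompl_le_nonZeroDivisors (pointIdeal P))
    apply_fun HomogeneousLocalization.val at hab hu hw
    simp only [HomogeneousLocalization.val_add, HomogeneousLocalization.val_mul] at hab hu hw
    simp only [map_mul, map_add, map_pow, x, ← val_germ_mul, hab, ← hu, ← hw]
    ring
  refine ⟨p + q + (c + d), ⟨s.1 * s'.1 * x ^ (c + d),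
    (s.2.mul s'.2).mul (isHomogeneous_X_pow _ _)⟩, ?_, Ideal.mem_span_pair.mpr ⟨_, _, cleared⟩⟩
  simpa [x, hs, hs'] using fun h => (chart_spec P h).elim

end PlaneGerm

section CurveGerm

variable {f : Form 4} {P : Point f} {d e n : ℕ}

variable (P) in
/-- The germ on `C` at `P` of a form, in the chart used by `germ`; its order is the intersection
multiplicity `mult`. -/
def curveGerm : Form d →+ CurveLocalRing f P :=
  (Ideal.Quotient.mk (Ideal.span {germ f P.1})).toAddMonoidHom.comp
    (AddMonoidHom.mk' (germ · P.1) germ_add)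

theorem mult_eq_ord (g : Form d) : mult f g P = Ring.ord (CurveLocalRing f P) (curveGerm P g) :=
  rfl

theorem curveGerm_mulForm (g : Form d) (hn : d + e = n) (h : Form e) :
    curveGerm P (mulForm g hn h) = curveGerm P g * curveGerm P h := by
  change Ideal.Quotient.mk _ (germ _ _) = _
  rw [germ_mulForm, map_mul]
  rfl

theorem curveGerm_self : curveGerm P f = 0 :=
  Ideal.Quotient.eq_zero_iff_mem.mpr (Ideal.mem_span_singleton_self _)

instance : Nontrivial (CurveLocalRing f P) := by
  rw [Ideal.Quotient.nontrivial_iff, Ne, Ideal.span_singleton_eq_top, isUnit_germ_iff, not_not]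
  exact P.2

instance : IsLocalRing (CurveLocalRing f P) :=
  .of_surjective' (Ideal.Quotient.mk _) Ideal.Quotient.mk_surjective

theorem isUnit_curveGerm_iff {g : Form d} :
    IsUnit (curveGerm P g) ↔ eval P.1.rep g.1 ≠ 0 := by
  have := IsLocalHom.of_surjective (Ideal.Quotient.mk (Ideal.span {germ f P.1}))
    Ideal.Quotient.mk_surjective
  exact (isUnit_map_iff (Ideal.Quotient.mk (Ideal.span {germ f P.1})) _).trans isUnit_germ_iff

theorem exists_mul_curveGerm_eq (r : CurveLocalRing f P) :
    ∃ (d : ℕ) (g s : Form d), eval P.1.rep s.1 ≠ 0 ∧ r * curveGerm P s = curveGerm P g := by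
  obtain ⟨a, rfl⟩ := Ideal.Quotient.mk_surjective r
  obtain ⟨d, g, s, hs, h⟩ := exists_mul_germ_eq a
  exact ⟨d, g, s, hs, (map_mul _ _ _).symm.trans (congrArg _ h)⟩

theorem exists_mul_mem_span_of_curveGerm_dvd {g : Form d} {h : Form e}
    (hgh : curveGerm P g ∣ curveGerm P h) :
    ∃ (k : ℕ) (t : Form k), eval P.1.rep t.1 ≠ 0 ∧ t.1 * h.1 ∈ Ideal.span {f.1, g.1} := by
  obtain ⟨r, hr⟩ := hgh
  obtain ⟨a, rfl⟩ := Ideal.Quotient.mk_surjective r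
  have hr : Ideal.Quotient.mk _ (germ h P.1) = Ideal.Quotient.mk _ (germ g P.1 * a) := hr
  obtain ⟨b, hb⟩ := Ideal.mem_span_singleton.mp (Ideal.Quotient.eq.mp hr)
  exact exists_mul_mem_span_of_germ_eq (sub_eq_iff_eq_add.mp hb)

theorem curveGerm_eq_zero_of_dvd {g : Form d} (hfg : f.1 ∣ g.1) : curveGerm P g = 0 := by
  rcases lt_or_ge d 4 with hd | hd
  · have hg : g = 0 := Subtype.ext (eq_zero_of_isHomogeneous_of_dvd f.2 g.2 hd hfg)
    rw [hg, map_zero]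
  · obtain ⟨k, rfl⟩ := exists_eq_mulForm f (Nat.add_sub_of_le hd) hfg
    rw [curveGerm_mulForm, curveGerm_self, zero_mul]

theorem curveGerm_eq_zero_iff (hf : Prime f.1) {g : Form d} :
    curveGerm P g = 0 ↔ f.1 ∣ g.1 := by
  refine ⟨fun hg => ?_, curveGerm_eq_zero_of_dvd⟩
  obtain ⟨k, t, ht, hmem⟩ := exists_mul_mem_span_of_curveGerm_dvd (P := P) (g := (0 : Form 0))
    (h := g) (hg ▸ dvd_zero _)
  rw [ZeroMemClass.coe_zero, Ideal.span_pair_zero, Ideal.mem_span_singleton] at hmem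
  refine (hf.dvd_or_dvd hmem).resolve_left fun hft => ht ?_
  obtain ⟨w, hw⟩ := hft
  rw [hw, map_mul, P.2, zero_mul]

theorem isDomain_curveLocalRing (hf : Prime f.1) (P : Point f) :
    IsDomain (CurveLocalRing f P) := by
  refine @NoZeroDivisors.to_isDomain _ _ _ ⟨fun {a b} hab => ?_⟩
  obtain ⟨d, g, s, hs, hg⟩ := exists_mul_curveGerm_eq a
  obtain ⟨e, h, t, ht, hh⟩ := exists_mul_curveGerm_eq b
  have hgh : curveGerm P (mulForm g rfl h) = 0 := by
    rw [curveGerm_mulForm, ← hg, ← hh, mul_mul_mul_comm, hab, zero_mul]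
  rw [curveGerm_eq_zero_iff hf, coe_mulForm] at hgh
  refine (hf.dvd_or_dvd hgh).imp (fun hfg => ?_) fun hfh => ?_
  · rwa [← curveGerm_eq_zero_iff hf, ← hg, (isUnit_curveGerm_iff.mpr hs).mul_left_eq_zero] at hfg
  · rwa [← curveGerm_eq_zero_iff hf, ← hh, (isUnit_curveGerm_iff.mpr ht).mul_left_eq_zero] at hfh

end CurveGerm

/-! ### Lines through a point -/

section ChartLines

variable {P : Plane} {d : ℕ}

/-- For `k = 1, 2`, the two lines `v_i X_{i + k} - v_{i + k} X_i` through the point `P`, where `v`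
represents `P` and `i = chart P` (indices modulo 3). In the chart `X_i ≠ 0` these are the
translated affine coordinates at `P`. -/
def chartLine (P : Plane) (k : Fin 3) : Form 1 :=
  ⟨C (P.rep (chart P)) * X (chart P + k) - C (P.rep (chart P + k)) * X (chart P),
    .sub ((isHomogeneous_X _ _).C_mul _) ((isHomogeneous_X _ _).C_mul _)⟩

theorem eval_chartLine (P : Plane) (k : Fin 3) (v : Fin 3 → ℂ) :
    eval v (chartLine P k).1
      = P.rep (chart P) * v (chart P + k) - P.rep (chart P + k) * v (chart P) := by
  simp [chartLine]

theorem eval_rep_chartLine (P : Plane) (k : Fin 3) : eval P.rep (chartLine P k).1 = 0 := by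
  rw [eval_chartLine, mul_comm, sub_self]

theorem chartLine_ne_zero (P : Plane) {k : Fin 3} (hk : k ≠ 0) : chartLine P k ≠ 0 := fun h => by
  have h1 := eval_chartLine P k (Pi.single (chart P + k) 1)
  rw [h, Pi.single_eq_same, Pi.single_eq_of_ne (by simpa using hk)] at h1
  exact chart_spec P (by simpa using h1.symm)

theorem exists_eq_chartLine_mul_add (g : Form (1 + d)) (hg : eval P.rep g.1 = 0) :
    ∃ a b : Form d, g = mulForm (chartLine P 1) rfl a + mulForm (chartLine P 2) rfl b := by
  have hmem := mem_span_of_eval_eq_zero (chart_spec P).isUnit g.2 hg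
  obtain ⟨c, hc⟩ := (Ideal.mem_span_range_iff_exists_fun).mp hmem
  have hsum (k : Fin 3) := homogeneousComponent_mul (chartLine P k).2 (c (chart P + k)) d
  refine ⟨⟨homogeneousComponent d (c (chart P + 1)), homogeneousComponent_mem _ _⟩,
    ⟨homogeneousComponent d (c (chart P + 2)), homogeneousComponent_mem _ _⟩, Subtype.ext ?_⟩
  change g.1 = (chartLine P 1).1 * homogeneousComponent d (c (chart P + 1))
    + (chartLine P 2).1 * homogeneousComponent d (c (chart P + 2))
  rw [← hsum, ← hsum, ← map_add, ← homogeneousComponent_eq_self g.2, ← hc,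
    ← Equiv.sum_comp (Equiv.addLeft (chart P)), Fin.sum_univ_three]
  simp [chartLine, mul_comm]

theorem exists_line_through_not_through {P Q : Plane} (hPQ : P ≠ Q) :
    ∃ L : Form 1, eval Q.rep L.1 = 0 ∧ eval P.rep L.1 ≠ 0 := by
  by_contra! hL
  refine hPQ ?_
  rw [← P.mk_rep, ← Q.mk_rep, Projectivization.mk_eq_mk_iff']
  refine ⟨P.rep (chart Q) / Q.rep (chart Q), funext fun j => ?_⟩
  have hj := hL _ (eval_rep_chartLine Q (j - chart Q))
  rw [eval_chartLine, add_sub_cancel] at hj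
  have hQ := chart_spec Q
  simp only [Pi.smul_apply, smul_eq_mul]
  field_simp
  linear_combination -hj

end ChartLines

/-! ### Intersection multiplicities at a point of a smooth quartic -/

section LocalParameter

variable {f : Form 4} {P : Point f} {d e n : ℕ}

theorem IsSmooth.exists_eq_chartLine_mul_add (hf : IsSmooth f) (P : Point f) :
    ∃ a b : Form 3, f = mulForm (chartLine P.1 1) rfl a + mulForm (chartLine P.1 2) rfl b ∧
      (eval P.1.rep a.1 ≠ 0 ∨ eval P.1.rep b.1 ≠ 0) := by
  obtain ⟨a, b, hab⟩ := PlaneQuartic.exists_eq_chartLine_mul_add (d := 3) f P.2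
  refine ⟨a, b, hab, ?_⟩
  by_contra! h0
  obtain ⟨i, hi⟩ := hf _ P.1.rep_nonzero P.2
  refine hi ((congrArg (fun g : Form 4 => eval P.1.rep (pderiv i g.1)) hab).trans ?_)
  simp [Derivation.leibniz, eval_rep_chartLine, h0.1, h0.2]

theorem exists_forall_curveGerm_dvd_chartLine (hf : IsSmooth f) (P : Point f) :
    ∃ k₀ ≠ 0, ∀ k ∈ ({1, 2} : Set (Fin 3)),
      curveGerm P (chartLine P.1 k₀) ∣ curveGerm P (chartLine P.1 k) := by
  obtain ⟨a, b, hab, hne⟩ := hf.exists_eq_chartLine_mul_add P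
  have h0 : curveGerm P (chartLine P.1 1) * curveGerm P a
      + curveGerm P (chartLine P.1 2) * curveGerm P b = 0 := by
    rw [← curveGerm_mulForm _ rfl, ← curveGerm_mulForm _ rfl, ← map_add, ← hab, curveGerm_self]
  rcases hne with ha | hb
  · refine ⟨2, by decide, ?_⟩
    rintro _ (rfl | rfl)
    · exact (isUnit_curveGerm_iff.mpr ha).dvd_mul_right.mp
        ⟨-curveGerm P b, by linear_combination h0⟩
    · rfl
  · refine ⟨1, by decide, ?_⟩
    rintro _ (rfl | rfl)
    · rfl
    · exact (isUnit_curveGerm_iff.mpr hb).dvd_mul_right.mp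
        ⟨-curveGerm P a, by linear_combination h0⟩

theorem exists_maximalIdeal_eq_span (hf : IsSmooth f) (P : Point f) :
    ∃ T : Form 1, curveGerm P T ≠ 0 ∧
      IsLocalRing.maximalIdeal (CurveLocalRing f P) = Ideal.span {curveGerm P T} := by
  obtain ⟨k₀, hk₀, hdvd⟩ := exists_forall_curveGerm_dvd_chartLine hf P
  have hT (k) : eval P.1.rep (chartLine P.1 k).1 = 0 := eval_rep_chartLine P.1 k
  refine ⟨chartLine P.1 k₀, fun h => ?_, le_antisymm (fun r hr => ?_) ?_⟩
  · rw [curveGerm_eq_zero_iff hf.prime] at h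
    exact chartLine_ne_zero P.1 hk₀ (Subtype.ext
      (eq_zero_of_isHomogeneous_of_dvd f.2 (chartLine P.1 k₀).2 (by decide) h))
  · obtain ⟨d, g, s, hs, hg⟩ := exists_mul_curveGerm_eq r
    let x : Form 1 := ⟨X (chart P.1), isHomogeneous_X _ _⟩
    have hx : IsUnit (curveGerm P x) := isUnit_curveGerm_iff.mpr (by simpa [x] using chart_spec P.1)
    have hg0 : eval P.1.rep g.1 = 0 := by
      by_contra hg0
      rw [← Ne, ← isUnit_curveGerm_iff, ← hg] at hg0
      exact hr (isUnit_of_mul_isUnit_left hg0)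
    obtain ⟨a, b, hab⟩ := PlaneQuartic.exists_eq_chartLine_mul_add (P := P.1) (mulForm x rfl g)
      (by simp [hg0])
    rw [Ideal.mem_span_singleton, ← (isUnit_curveGerm_iff.mpr hs).dvd_mul_right, hg,
      ← hx.dvd_mul_left, ← curveGerm_mulForm x rfl, hab, map_add, curveGerm_mulForm,
      curveGerm_mulForm]
    exact dvd_add ((hdvd 1 (by simp)).mul_right _) ((hdvd 2 (by simp)).mul_right _)
  · rw [Ideal.span_singleton_le_iff_mem, IsLocalRing.mem_maximalIdeal, mem_nonunits_iff,
      isUnit_curveGerm_iff, not_not]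
    exact hT k₀

theorem mult_eq_zero_iff {g : Form d} : mult f g P = 0 ↔ eval P.1.rep g.1 ≠ 0 := by
  rw [mult_eq_ord, ord_eq_zero_iff, isUnit_curveGerm_iff]

theorem one_le_mult_iff {g : Form d} : 1 ≤ mult f g P ↔ eval P.1.rep g.1 = 0 := by
  rw [Order.one_le_iff_ne_zero, Ne, mult_eq_zero_iff, not_not]

theorem exists_mult_eq_one (hf : IsSmooth f) (P : Point f) : ∃ T : Form 1, mult f T P = 1 := by
  obtain ⟨T, -, hT⟩ := exists_maximalIdeal_eq_span hf P
  exact ⟨T, ord_eq_one_of_maximalIdeal_eq_span hT⟩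

theorem mult_eq_top_of_dvd (hf : IsSmooth f) (P : Point f) {g : Form d} (hfg : f.1 ∣ g.1) :
    mult f g P = ⊤ := by
  have := isDomain_curveLocalRing hf.prime P
  obtain ⟨T, hT0, hT⟩ := exists_maximalIdeal_eq_span hf P
  rw [mult_eq_ord, curveGerm_eq_zero_of_dvd hfg, ord_zero_eq_top hT hT0]

theorem mult_mulForm (hf : IsSmooth f) (P : Point f) (g : Form d) (hn : d + e = n) (h : Form e) :
    mult f (mulForm g hn h) P = mult f g P + mult f h P := by
  have := isDomain_curveLocalRing hf.prime P
  by_cases hfh : f.1 ∣ h.1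
  · rw [mult_eq_top_of_dvd hf P hfh, mult_eq_top_of_dvd hf P (hfh.mul_left _), add_top]
  · rw [mult_eq_ord, curveGerm_mulForm, Ring.ord_mul, mult_eq_ord, mult_eq_ord]
    exact mem_nonZeroDivisors_of_ne_zero (mt (curveGerm_eq_zero_iff hf.prime).mp hfh)

theorem le_mult_add (hf : IsSmooth f) {g h : Form d} {k : ℕ} (hg : k ≤ mult f g P)
    (hh : k ≤ mult f h P) : k ≤ mult f (g + h) P := by
  have := isDomain_curveLocalRing hf.prime P
  obtain ⟨T, hT0, hT⟩ := exists_maximalIdeal_eq_span hf P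
  rw [mult_eq_ord, natCast_le_ord_iff hT hT0] at hg hh ⊢
  rw [map_add]
  exact dvd_add hg hh

/-- A constant, as a form of degree zero. -/
def constForm (c : ℂ) : Form 0 := ⟨C c, isHomogeneous_C _ c⟩

theorem curveGerm_smul (c : ℂ) (g : Form d) :
    curveGerm P (c • g) = curveGerm P (constForm c) * curveGerm P g := by
  rw [← curveGerm_mulForm _ (zero_add d)]
  exact congrArg _ (Subtype.ext (smul_eq_C_mul _ _))

theorem mult_le_mult_smul (c : ℂ) (g : Form d) : mult f g P ≤ mult f (c • g) P := by
  rw [mult_eq_ord, mult_eq_ord, curveGerm_smul]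
  exact Ring.ord_le_ord_mul _ _

theorem exists_sub_constForm_mem_maximalIdeal (r : CurveLocalRing f P) :
    ∃ c, r - curveGerm P (constForm c) ∈ IsLocalRing.maximalIdeal (CurveLocalRing f P) := by
  obtain ⟨d, g, s, hs, hg⟩ := exists_mul_curveGerm_eq r
  let c := eval P.1.rep g.1 / eval P.1.rep s.1
  have hprod : (r - curveGerm P (constForm c)) * curveGerm P s = curveGerm P (g - c • s) := by
    rw [sub_mul, hg, map_sub, curveGerm_smul]
  refine ⟨c, fun hu => ?_⟩
  have hu := hu.mul (isUnit_curveGerm_iff.mpr hs)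
  rw [hprod, isUnit_curveGerm_iff] at hu
  exact hu (by simp [c, hs])

theorem exists_succ_le_mult_sub_smul (hf : IsSmooth f) {g h : Form d} {k : ℕ}
    (hg : mult f g P = k) (hh : k ≤ mult f h P) :
    ∃ c : ℂ, (k + 1 : ℕ) ≤ mult f (h - c • g) P := by
  have := isDomain_curveLocalRing hf.prime P
  obtain ⟨T, hT0, hT⟩ := exists_maximalIdeal_eq_span hf P
  obtain ⟨r, hr⟩ : curveGerm P g ∣ curveGerm P h :=
    dvd_of_ord_le hT hT0 (hg.trans_ne (ENat.natCast_ne_top k)) (hg.trans_le hh)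
  obtain ⟨c, hc⟩ := exists_sub_constForm_mem_maximalIdeal r
  refine ⟨c, ?_⟩
  rw [mult_eq_ord, natCast_le_ord_iff hT hT0, map_sub, hr, curveGerm_smul,
    mul_comm (curveGerm P (constForm c)), ← mul_sub, pow_succ]
  rw [hT, Ideal.mem_span_singleton] at hc
  exact mul_dvd_mul ((natCast_le_ord_iff hT hT0).mp hg.ge) hc

end LocalParameter

/-! ### Forms with prescribed zeros -/

section Vanishing

variable {f : Form 4} {n : ℕ}

instance : DecidableEq (Point f) := Classical.decEq _

/-- The linear system of the forms of degree `n` whose divisor on the quartic is at least the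
effective divisor `s`, encoded as a multiset of points. -/
def vanishing (hf : IsSmooth f) (n : ℕ) (s : Multiset (Point f)) : Submodule ℂ (Form n) where
  carrier := {h | ∀ P, s.count P ≤ mult f h P}
  add_mem' hg hh P := le_mult_add hf (hg P) (hh P)
  zero_mem' P := by simp [mult_eq_top_of_dvd hf P (g := (0 : Form n)) (dvd_zero _)]
  smul_mem' c g hg P := (hg P).trans (mult_le_mult_smul c g)

theorem mem_vanishing_cons_iff {hf : IsSmooth f} {P : Point f} {s : Multiset (Point f)}
    {h : Form n} :
    h ∈ vanishing hf n (P ::ₘ s) ↔ h ∈ vanishing hf n s ∧ (s.count P + 1 : ℕ) ≤ mult f h P := by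
  refine ⟨fun hh => ⟨fun Q => le_trans (mod_cast Multiset.count_le_count_cons Q P s) (hh Q), ?_⟩,
    fun ⟨hh, hP⟩ Q => ?_⟩
  · simpa only [Multiset.count_cons_self] using hh P
  · obtain rfl | hQ := eq_or_ne Q P
    · rwa [Multiset.count_cons_self]
    · rw [Multiset.count_cons_of_ne hQ]
      exact hh Q

theorem finrank_vanishing_le_finrank_vanishing_cons_add_one (hf : IsSmooth f) (n : ℕ)
    (P : Point f) (s : Multiset (Point f)) :
    Module.finrank ℂ (vanishing hf n s) ≤ Module.finrank ℂ (vanishing hf n (P ::ₘ s)) + 1 := by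
  by_cases hle : vanishing hf n s ≤ vanishing hf n (P ::ₘ s)
  · exact (Submodule.finrank_mono hle).trans (Nat.le_succ _)
  obtain ⟨g, hg, hg'⟩ := Set.not_subset.mp hle
  have hgP : mult f g P = s.count P := by
    refine le_antisymm (not_lt.mp fun hlt => hg' (mem_vanishing_cons_iff.mpr ⟨hg, ?_⟩)) (hg P)
    exact mod_cast Order.add_one_le_of_lt hlt
  have hsup : vanishing hf n s ≤ vanishing hf n (P ::ₘ s) ⊔ Submodule.span ℂ {g} := by
    intro h hh
    obtain ⟨c, hc⟩ := exists_succ_le_mult_sub_smul hf hgP (hh P)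
    have hsub : h - c • g ∈ vanishing hf n (P ::ₘ s) :=
      mem_vanishing_cons_iff.mpr ⟨sub_mem hh (Submodule.smul_mem _ c hg), hc⟩
    exact Submodule.mem_sup.mpr ⟨_, hsub, c • g, Submodule.mem_span_singleton.mpr ⟨c, rfl⟩,
      sub_add_cancel h _⟩
  calc Module.finrank ℂ (vanishing hf n s)
      ≤ Module.finrank ℂ ↥(vanishing hf n (P ::ₘ s) ⊔ Submodule.span ℂ {g}) :=
        Submodule.finrank_mono hsup
    _ ≤ Module.finrank ℂ (vanishing hf n (P ::ₘ s)) + Module.finrank ℂ (Submodule.span ℂ {g}) :=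
        Submodule.finrank_add_le_finrank_add_finrank _ _
    _ ≤ Module.finrank ℂ (vanishing hf n (P ::ₘ s)) + 1 := by
        gcongr
        simpa using finrank_span_le_card (R := ℂ) ({g} : Set (Form n))

theorem finrank_form_le_finrank_vanishing_add_card (hf : IsSmooth f) (n : ℕ)
    (s : Multiset (Point f)) :
    Module.finrank ℂ (Form n) ≤ Module.finrank ℂ (vanishing hf n s) + s.card := by
  induction s using Multiset.induction_on with
  | empty =>
    have htop : vanishing hf n 0 = ⊤ := eq_top_iff.mpr fun h _ P => by simp
    rw [htop, finrank_top, Multiset.card_zero, add_zero]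
  | cons P s ih =>
    have := finrank_vanishing_le_finrank_vanishing_cons_add_one hf n P s
    rw [Multiset.card_cons]
    lia

theorem exists_line_one_le_mult (hf : IsSmooth f) (P Q : Point f) :
    ∃ L : Form 1, 1 ≤ mult f L Q ∧ mult f L P = if P = Q then 1 else 0 := by
  split_ifs with h
  · subst h
    obtain ⟨T, hT⟩ := exists_mult_eq_one hf P
    exact ⟨T, hT.ge, hT⟩
  · obtain ⟨L, hLQ, hLP⟩ := exists_line_through_not_through (mt Subtype.ext h)
    exact ⟨L, one_le_mult_iff.mpr hLQ, mult_eq_zero_iff.mpr hLP⟩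

theorem exists_mem_vanishing_mult_eq_count (hf : IsSmooth f) (P : Point f)
    {s : Multiset (Point f)} (hn : s.card ≤ n) :
    ∃ h ∈ vanishing hf n s, mult f h P = s.count P := by
  induction s using Multiset.induction_on generalizing n with
  | empty =>
    refine ⟨⟨X (chart P.1) ^ n, X_chart_pow_form P.1 n⟩, fun Q => by simp, ?_⟩
    rw [Multiset.count_zero, Nat.cast_zero, mult_eq_zero_iff]
    simpa using pow_ne_zero n (chart_spec P.1)
  | cons Q s ih =>
    rw [Multiset.card_cons] at hn
    obtain ⟨m, rfl⟩ := Nat.exists_eq_add_of_le' (le_trans (Nat.le_add_left 1 _) hn)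
    obtain ⟨h, hh, hP⟩ := ih (n := m) (by lia)
    obtain ⟨L, hL, hLP⟩ := exists_line_one_le_mult hf P Q
    have hmul (R : Point f) := mult_mulForm hf R h rfl L
    refine ⟨mulForm h rfl L, mem_vanishing_cons_iff.mpr ⟨fun R => ?_, ?_⟩, ?_⟩
    · exact (hh R).trans (hmul R ▸ le_self_add)
    · rw [hmul, Nat.cast_add]
      exact add_le_add (hh Q) hL
    · rw [hmul, hP, hLP, Multiset.count_cons]
      split_ifs <;> simp

theorem finrank_vanishing_add_card_le (hf : IsSmooth f) {s : Multiset (Point f)}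
    (hn : s.card ≤ n) :
    Module.finrank ℂ (vanishing hf n s) + s.card ≤ Module.finrank ℂ (Form n) := by
  induction s using Multiset.induction_on with
  | empty => simpa using Submodule.finrank_le _
  | cons P s ih =>
    rw [Multiset.card_cons] at hn ⊢
    obtain ⟨h, hh, hP⟩ := exists_mem_vanishing_mult_eq_count hf P (Nat.le_of_succ_le hn)
    have hnot : h ∉ vanishing hf n (P ::ₘ s) := fun hh' => by
      have hle := (mem_vanishing_cons_iff.mp hh').2
      rw [hP, Nat.cast_le] at hle
      exact Nat.not_succ_le_self _ hle
    have hlt : vanishing hf n (P ::ₘ s) < vanishing hf n s :=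
      SetLike.lt_iff_le_and_exists.mpr
        ⟨fun _ hg => (mem_vanishing_cons_iff.mp hg).1, h, hh, hnot⟩
    have := Submodule.finrank_lt_finrank_of_lt hlt
    have := ih (Nat.le_of_succ_le hn)
    lia

end Vanishing

/-! ### Bézout's theorem -/

section Bezout

variable {f : Form 4} {d n : ℕ}

theorem range_combinations_le_vanishing (hf : IsSmooth f) {g : Form d} {s : Multiset (Point f)}
    (hs : g ∈ vanishing hf d s) (e : ℕ) :
    LinearMap.range (combinations f g e) ≤ vanishing hf (4 + d + e) s := by
  rintro _ ⟨⟨u, w⟩, rfl⟩ P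
  refine le_mult_add hf (le_top.trans_eq (mult_eq_top_of_dvd hf P (dvd_mul_right f.1 u.1)).symm) ?_
  exact (hs P).trans (le_self_add.trans_eq (mult_mulForm hf P g (by lia) w).symm)

theorem card_le_of_mem_vanishing (hf : IsSmooth f) {g : Form d} (hg : ¬ f.1 ∣ g.1)
    {s : Multiset (Point f)} (hs : g ∈ vanishing hf d s) : s.card ≤ 4 * d := by
  have hrange := Submodule.finrank_mono (range_combinations_le_vanishing hf hs s.card)
  have hcodim := finrank_form_le_range_combinations_add hf.prime hg s.card
  have hvanishing := finrank_vanishing_add_card_le hf (Nat.le_add_left s.card (4 + d))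
  lia

theorem exists_mult_eq_count (hf : IsSmooth f) {g : Form d} (hg : ¬ f.1 ∣ g.1) :
    ∃ s : Multiset (Point f), ∀ P, mult f g P = s.count P := by
  obtain ⟨s, hs, hmax⟩ := WellFounded.has_min
    (measure fun s : Multiset (Point f) => 4 * d - s.card).wf
    {s | g ∈ vanishing hf d s} ⟨0, fun P => by simp⟩
  refine ⟨s, fun P => le_antisymm (not_lt.mp fun hlt => ?_) (hs P)⟩
  have hPs : g ∈ vanishing hf d (P ::ₘ s) :=
    mem_vanishing_cons_iff.mpr ⟨hs, mod_cast Order.add_one_le_of_lt hlt⟩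
  have hcard := card_le_of_mem_vanishing hf hg hPs
  rw [Multiset.card_cons] at hcard
  refine hmax _ hPs ?_
  change 4 * d - (P ::ₘ s).card < 4 * d - s.card
  rw [Multiset.card_cons]
  lia

theorem exists_mul_mem_span_of_mult_le (hf : IsSmooth f) {P : Point f} {g : Form d} {h : Form n}
    (hg : mult f g P ≠ ⊤) (hle : mult f g P ≤ mult f h P) :
    ∃ (k : ℕ) (t : Form k), eval P.1.rep t.1 ≠ 0 ∧ t.1 * h.1 ∈ Ideal.span {f.1, g.1} := by
  have := isDomain_curveLocalRing hf.prime P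
  obtain ⟨T, hT0, hT⟩ := exists_maximalIdeal_eq_span hf P
  exact exists_mul_mem_span_of_curveGerm_dvd (dvd_of_ord_le hT hT0 hg hle)

theorem exists_mul_mem_span_of_forall_mult_le (hf : IsSmooth f) {g : Form d} {h : Form n}
    (hg : ∀ P, mult f g P ≠ ⊤) (hle : ∀ P, mult f g P ≤ mult f h P) {v : Fin 3 → ℂ} (hv : v ≠ 0) :
    ∃ t, eval v t ≠ 0 ∧ t * h.1 ∈ Ideal.span {f.1, g.1} := by
  by_cases hfv : eval v f.1 = 0
  · obtain ⟨a, ha⟩ := Projectivization.exists_smul_eq_mk_rep ℂ v hv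
    have hrep {k : ℕ} (t : Form k) : eval (Projectivization.mk ℂ v hv).rep t.1
        = (a : ℂ) ^ k * eval v t.1 := by
      rw [← ha]
      exact eval_smul_of_isHomogeneous t.2 _ v
    obtain ⟨k, t, ht, hmem⟩ := exists_mul_mem_span_of_mult_le hf
      (P := ⟨Projectivization.mk ℂ v hv, by rw [hrep, hfv, mul_zero]⟩) (hg _) (hle _)
    rw [hrep] at ht
    exact ⟨t.1, right_ne_zero_of_mul ht, hmem⟩
  · exact ⟨f.1, hfv, Ideal.mul_mem_right _ _ (Ideal.subset_span (Set.mem_insert _ _))⟩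

/-- The ideal generated by the forms whose divisor on the quartic is at least that of `g`. -/
def divisorIdeal (f : Form 4) (g : Form d) : Ideal (MvPolynomial (Fin 3) ℂ) :=
  Ideal.span {p | ∃ (n : ℕ) (h : Form n), (∀ P, mult f g P ≤ mult f h P) ∧ h.1 = p}

theorem exists_finset_span_eq_divisorIdeal (f : Form 4) (g : Form d) :
    ∃ s : Finset (MvPolynomial (Fin 3) ℂ),
      (∀ p ∈ s, ∃ (n : ℕ) (h : Form n), (∀ P, mult f g P ≤ mult f h P) ∧ h.1 = p) ∧
      divisorIdeal f g = Ideal.span s :=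
  (Submodule.fg_span_iff_fg_span_finset_subset _).mp (IsNoetherian.noetherian (divisorIdeal f g))

theorem zeroLocus_colon_divisorIdeal_subset (hf : IsSmooth f) {g : Form d}
    (hg : ∀ P, mult f g P ≠ ⊤) :
    zeroLocus ℂ ((Ideal.span {f.1, g.1}).colon (divisorIdeal f g : Set _)) ⊆ {0} := by
  intro v hv
  by_contra hv0
  obtain ⟨s, hs, hspan⟩ := exists_finset_span_eq_divisorIdeal f g
  have hlocal (p) (hp : p ∈ s) : ∃ t, eval v t ≠ 0 ∧ t * p ∈ Ideal.span {f.1, g.1} := by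
    obtain ⟨n, h, hle, rfl⟩ := hs p hp
    exact exists_mul_mem_span_of_forall_mult_le hf hg hle hv0
  choose! t ht hmem using hlocal
  refine Finset.prod_ne_zero_iff.mpr ht ?_
  rw [← map_prod, ← aeval_eq_eval]
  refine hv _ ?_
  rw [hspan, Ideal.span, Submodule.colon_span, Submodule.mem_colon]
  intro p hp
  obtain ⟨q, hq⟩ := Finset.dvd_prod_of_mem t hp
  rw [smul_eq_mul, hq, mul_right_comm]
  exact Ideal.mul_mem_right _ _ (hmem p hp)

theorem exists_forall_mem_span_of_mult_le (hf : IsSmooth f) {g : Form d}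
    (hg : ∀ P, mult f g P ≠ ⊤) :
    ∃ N, ∀ n ≥ N, ∀ h : Form n, (∀ P, mult f g P ≤ mult f h P) →
      h.1 ∈ Ideal.span {f.1, g.1} := by
  obtain ⟨N, hN⟩ := exists_forall_isHomogeneous_mem (zeroLocus_colon_divisorIdeal_subset hf hg)
  obtain ⟨s, hs, hspan⟩ := exists_finset_span_eq_divisorIdeal f g
  choose m q hq hqp using fun p : s => hs p p.2
  refine ⟨N + Finset.univ.sup m, fun n hn h hle => ?_⟩
  have hmem : h.1 ∈ Ideal.span (s : Set (MvPolynomial (Fin 3) ℂ)) :=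
    hspan ▸ Ideal.subset_span ⟨n, h, hle, rfl⟩
  obtain ⟨c, hc⟩ := Submodule.mem_span_finset'.mp hmem
  rw [← homogeneousComponent_eq_self h.2, ← hc, map_sum]
  refine sum_mem fun p _ => ?_
  have hm : m p ≤ Finset.univ.sup m := Finset.le_sup (Finset.mem_univ p)
  obtain ⟨e, rfl⟩ : ∃ e, n = m p + e := Nat.exists_eq_add_of_le (by lia)
  have hcolon := hN e (by lia) _ (homogeneousComponent_isHomogeneous e (c p))
  rw [smul_eq_mul, mul_comm, ← hqp p, homogeneousComponent_mul (q p).2, mul_comm]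
  exact Submodule.mem_colon.mp hcolon _ (Ideal.subset_span ⟨m p, q p, hq p, rfl⟩)

theorem exists_mult_eq_count_card_eq (hf : IsSmooth f) {g : Form d} (hg : ¬ f.1 ∣ g.1) :
    ∃ s : Multiset (Point f), (∀ P, mult f g P = s.count P) ∧ s.card = 4 * d := by
  obtain ⟨s, hs⟩ := exists_mult_eq_count hf hg
  refine ⟨s, hs, (card_le_of_mem_vanishing hf hg fun P => (hs P).ge).antisymm ?_⟩
  obtain ⟨N, hN⟩ := exists_forall_mem_span_of_mult_le hf (g := g)
    fun P => (hs P).trans_ne (ENat.natCast_ne_top _)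
  have hle : vanishing hf (4 + d + N) s ≤ LinearMap.range (combinations f g N) := fun h hh =>
    mem_range_combinations (hN _ (Nat.le_add_left N _) h fun P => (hs P).trans_le (hh P))
  have hvanishing := finrank_form_le_finrank_vanishing_add_card hf (4 + d + N) s
  have hrange := finrank_range_combinations_add_le
    (Or.inl fun h0 => hf.ne_zero (congrArg Subtype.val h0) : f ≠ 0 ∨ g ≠ 0) N
  have := Submodule.finrank_mono hle
  lia

end Bezout

/-! ### The addition algorithm -/

section Effective

variable {f : Form 4} {d : ℕ}

/-- The effective divisor in which each point is counted as often as in the multiset `s`. -/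
def ofMultiset (s : Multiset (Point f)) : Divisor f := (s.map pt).sum

theorem ofMultiset_add (s t : Multiset (Point f)) :
    ofMultiset (s + t) = ofMultiset s + ofMultiset t := by
  rw [ofMultiset, Multiset.map_add, Multiset.sum_add, ofMultiset, ofMultiset]

theorem ofMultiset_apply (s : Multiset (Point f)) (P : Point f) : ofMultiset s P = s.count P := by
  induction s using Multiset.induction_on with
  | empty => simp [ofMultiset]
  | cons Q s ih =>
    rw [ofMultiset] at ih ⊢
    rw [Multiset.map_cons, Multiset.sum_cons, Finsupp.add_apply, ih, Multiset.count_cons,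
      Finsupp.single_apply, Nat.cast_add, Nat.cast_ite, Nat.cast_one, Nat.cast_zero, add_comm]
    simp only [eq_comm]

theorem degree_ofMultiset (s : Multiset (Point f)) : degree (ofMultiset s) = s.card := by
  rw [ofMultiset, map_multiset_sum]
  simp

theorem ofMultiset_nonneg (s : Multiset (Point f)) : 0 ≤ ofMultiset s := fun P =>
  (ofMultiset_apply s P).symm ▸ Int.natCast_nonneg _

theorem exists_eq_ofMultiset {D : Divisor f} (hD : 0 ≤ D) : ∃ s, D = ofMultiset s := by
  refine ⟨Finsupp.toMultiset (D.mapRange Int.toNat rfl), Finsupp.ext fun P => ?_⟩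
  rw [ofMultiset_apply, Finsupp.count_toMultiset, Finsupp.mapRange_apply,
    Int.toNat_of_nonneg (hD P)]

theorem pt_nonneg (P : Point f) : 0 ≤ pt P := Finsupp.single_nonneg.mpr zero_le_one

theorem degree_pt (P : Point f) : degree (pt P) = 1 := Finsupp.degree_single P 1

theorem tripleSum_nonneg (T : Fin 3 → Point f) : 0 ≤ tripleSum T :=
  Finset.sum_nonneg fun i _ => pt_nonneg (T i)

theorem degree_tripleSum (T : Fin 3 → Point f) : degree (tripleSum T) = 3 := by
  simp [tripleSum]

theorem not_dvd_of_ne_zero (hd : d < 4) {g : Form d} (hg : g ≠ 0) : ¬ f.1 ∣ g.1 :=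
  fun h => hg (Subtype.ext (eq_zero_of_isHomogeneous_of_dvd f.2 g.2 hd h))

theorem exists_intersectsIn (hf : IsSmooth f) (hd : d < 4) {D : Divisor f} (hD : 0 ≤ D)
    (hdeg : degree D < (d + 2).choose 2) :
    ∃ (g : Form d) (E : Divisor f), g ≠ 0 ∧ 0 ≤ E ∧ degree E = 4 * d - degree D ∧
      IntersectsIn g (D + E) := by
  obtain ⟨s, rfl⟩ := exists_eq_ofMultiset hD
  rw [degree_ofMultiset, Nat.cast_lt, ← finrank_form] at hdeg
  have hne : vanishing hf d s ≠ ⊥ := fun hbot => by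
    have hle := finrank_form_le_finrank_vanishing_add_card hf d s
    rw [hbot, finrank_bot] at hle
    lia
  obtain ⟨g, hg, hg0⟩ := Submodule.exists_mem_ne_zero_of_ne_bot hne
  obtain ⟨u, hu, hcard⟩ := exists_mult_eq_count_card_eq hf (not_dvd_of_ne_zero hd hg0)
  have hsu : s ≤ u := Multiset.le_iff_count.mpr fun P => mod_cast (hg P).trans_eq (hu P)
  obtain ⟨t, rfl⟩ := Multiset.le_iff_exists_add.mp hsu
  refine ⟨g, ofMultiset t, hg0, ofMultiset_nonneg t, ?_, fun P => ⟨_, hu P, ?_⟩⟩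
  · rw [Multiset.card_add] at hcard
    rw [degree_ofMultiset, degree_ofMultiset]
    lia
  · rw [← ofMultiset_add, ofMultiset_apply]

end Effective

section Steps

variable {f : Form 4} {P Q R S : Fin 3 → Point f} {B : Point f} {l : Form 1} {A : Divisor f}
  {c : Form 3} {E : Divisor f} {n : Form 2} {D : Divisor f}

theorem exists_stepLine (hf : IsSmooth f) (P : Fin 3 → Point f) : ∃ l A, StepLine P l A := by
  have hdeg : degree (pt (P 0) + pt (P 1)) = 2 := by
    simp only [map_add, degree_pt, one_add_one_eq_two]
  obtain ⟨l, A, hl, hA, hA2, hlA⟩ := exists_intersectsIn hf (d := 1) (by decide)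
    (add_nonneg (pt_nonneg (P 0)) (pt_nonneg (P 1))) (by rw [hdeg]; decide)
  exact ⟨l, A, hl, hA, by rw [hA2, hdeg]; rfl, hlA⟩

theorem StepLine.exists_stepCubic (hl : StepLine P l A) (hf : IsSmooth f) (Q R : Fin 3 → Point f)
    (B : Point f) : ∃ c E, StepCubic Q R A B c E := by
  obtain ⟨-, hA, hA2, -⟩ := hl
  have hdeg : degree (tripleSum Q + tripleSum R + A + pt B) = 9 := by
    simp only [map_add, degree_tripleSum, hA2, degree_pt]
    rfl
  have hnonneg := add_nonneg (add_nonneg (add_nonneg (tripleSum_nonneg Q) (tripleSum_nonneg R)) hA)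
    (pt_nonneg B)
  obtain ⟨c, E, hc, hE, hE3, hcE⟩ := exists_intersectsIn hf (d := 3) (by decide) hnonneg
    (by rw [hdeg]; decide)
  exact ⟨c, E, hc, hE, by rw [hE3, hdeg]; rfl, hcE⟩

theorem StepCubic.exists_stepConic (hc : StepCubic Q R A B c E) (hf : IsSmooth f)
    (P : Fin 3 → Point f) : ∃ n D, StepConic P B E n D := by
  obtain ⟨-, hE, hE3, -⟩ := hc
  have hdeg : degree (pt B + pt (P 2) + E) = 5 := by
    simp only [map_add, degree_pt, hE3]
    rfl
  obtain ⟨n, D, hn, hD, hD3, hnD⟩ := exists_intersectsIn hf (d := 2) (by decide)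
    (add_nonneg (add_nonneg (pt_nonneg B) (pt_nonneg (P 2))) hE) (by rw [hdeg]; decide)
  exact ⟨n, D, hn, hD, by rw [hD3, hdeg]; rfl, hnD⟩

theorem StepConic.exists_stepOutput (hn : StepConic P B E n D) : ∃ S, StepOutput D S := by
  obtain ⟨-, hD, hD3, -⟩ := hn
  obtain ⟨s, rfl⟩ := exists_eq_ofMultiset hD
  rw [degree_ofMultiset] at hD3
  obtain ⟨x, y, z, rfl⟩ := Multiset.card_eq_three.mp (mod_cast hD3)
  exact ⟨![x, y, z], by simp [StepOutput, tripleSum, ofMultiset, Fin.sum_univ_three, add_assoc]⟩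

theorem exists_isQuotient (hf : Prime f.1) (g : MvPolynomial (Fin 3) ℂ)
    {h : MvPolynomial (Fin 3) ℂ} (hh : ¬ f.1 ∣ h) : ∃ φ : Fractions f, IsQuotient φ g h := by
  rw [← Ideal.mem_span_singleton] at hh
  have hprime : (Ideal.span {f.1}).IsPrime := (Ideal.span_singleton_prime hf.ne_zero).mpr hf
  have : IsDomain (CoordRing f) := (Ideal.Quotient.isDomain_iff_prime _).mpr hprime
  have hne : toFractions f h ≠ 0 := by
    rwa [toFractions, Ne, FaithfulSMul.algebraMap_eq_zero_iff, Ideal.Quotient.eq_zero_iff_mem]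
  exact ⟨toFractions f g / toFractions f h, hh, div_mul_cancel₀ _ hne⟩

theorem IntersectsIn.mulForm (hf : IsSmooth f) {a b k : ℕ} {g : Form a} {h : Form b}
    {G H : Divisor f} (hg : IntersectsIn g G) (hab : a + b = k) (hh : IntersectsIn h H) :
    IntersectsIn (mulForm g hab h) (G + H) := fun P => by
  obtain ⟨i, hgi, hGi⟩ := hg P
  obtain ⟨j, hhj, hHj⟩ := hh P
  exact ⟨i + j, by rw [mult_mulForm hf, hgi, hhj, Nat.cast_add],
    by rw [Finsupp.add_apply, hGi, hHj, Nat.cast_add]⟩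

theorem IntersectsIn.hasDivisor {k : ℕ} {g h : Form k} {G H : Divisor f} {φ : Fractions f}
    (hg : IntersectsIn g G) (hh : IntersectsIn h H) (hφ : IsQuotient φ g.1 h.1) :
    HasDivisor φ (G - H) := fun P => by
  obtain ⟨i, hgi, hGi⟩ := hg P
  obtain ⟨j, hhj, hHj⟩ := hh P
  exact ⟨k, g, h, i, j, hφ, hgi, hhj, by rw [Finsupp.sub_apply, hGi, hHj]⟩

theorem intersection_cubic_sub_intersection_line_conic (hS : StepOutput D S) :
    tripleSum Q + tripleSum R + A + pt B + E
        - (pt (P 0) + pt (P 1) + A + (pt B + pt (P 2) + E + D))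
      = tripleSum Q + tripleSum R - tripleSum P - tripleSum S := by
  rw [← show tripleSum S = D from hS, tripleSum.eq_def P, Fin.sum_univ_three]
  abel

theorem exists_isQuotient_hasDivisor (hf : IsSmooth f) (hl : StepLine P l A)
    (hc : StepCubic Q R A B c E) (hn : StepConic P B E n D) (hS : StepOutput D S) :
    ∃ φ : Fractions f, IsQuotient φ c.1 (l.1 * n.1) ∧
      HasDivisor φ (tripleSum Q + tripleSum R - tripleSum P - tripleSum S) := by
  have hln : ¬ f.1 ∣ l.1 * n.1 := hf.prime.not_dvd_mul (not_dvd_of_ne_zero (by decide) hl.1)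
    (not_dvd_of_ne_zero (by decide) hn.1)
  obtain ⟨φ, hφ⟩ := exists_isQuotient hf.prime c.1 hln
  refine ⟨φ, hφ, ?_⟩
  have hdiv := hc.2.2.2.hasDivisor (hl.2.2.2.mulForm hf (rfl : 1 + 2 = 3) hn.2.2.2) hφ
  rwa [intersection_cubic_sub_intersection_line_conic hS] at hdiv

theorem linearlyEquivalent_tripleSum_sub (hf : IsSmooth f) (hl : StepLine P l A)
    (hc : StepCubic Q R A B c E) (hn : StepConic P B E n D) (hS : StepOutput D S) :
    LinearlyEquivalent (tripleSum S - tripleSum P)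
      ((tripleSum Q - tripleSum P) + (tripleSum R - tripleSum P)) := by
  obtain ⟨φ, hφ⟩ := exists_isQuotient hf.prime (l.1 * n.1) (not_dvd_of_ne_zero (by decide) hc.1)
  have hdiv := (hl.2.2.2.mulForm hf rfl hn.2.2.2).hasDivisor hc.2.2.2 hφ
  rw [← neg_sub, intersection_cubic_sub_intersection_line_conic hS] at hdiv
  refine ⟨φ, ?_⟩
  convert hdiv using 1
  abel

theorem LinearlyEquivalent.represents_add (h : LinearlyEquivalent (tripleSum S - tripleSum P)
      ((tripleSum Q - tripleSum P) + (tripleSum R - tripleSum P)))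
    {x y : Jacobian f} (hx : Represents P Q x) (hy : Represents P R y) :
    Represents P S (x + y) := by
  obtain ⟨φ, hφ⟩ := h
  rw [Represents] at hx hy ⊢
  rw [← hx, ← hy, ← QuotientAddGroup.mk_add, eq_comm, QuotientAddGroup.eq,
    AddSubgroup.mem_addSubgroupOf]
  refine AddSubgroup.subset_closure ⟨φ, ?_⟩
  convert hφ using 1
  exact neg_add_eq_sub _ _

end Steps

end PlaneQuartic

end

theorem mainTheorem4 (f : PlaneQuartic.Form 4) (hf : PlaneQuartic.IsSmooth f)
    (P Q R : Fin 3 → PlaneQuartic.Point f) (B : PlaneQuartic.Point f) :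
    -- every step can be carried out, whatever was chosen in the steps before it
    (∃ (l : PlaneQuartic.Form 1) (A : PlaneQuartic.Divisor f), PlaneQuartic.StepLine P l A) ∧
    (∀ (l : PlaneQuartic.Form 1) (A : PlaneQuartic.Divisor f), PlaneQuartic.StepLine P l A →
      ∃ (c : PlaneQuartic.Form 3) (E : PlaneQuartic.Divisor f),
        PlaneQuartic.StepCubic Q R A B c E) ∧
    (∀ (l : PlaneQuartic.Form 1) (A : PlaneQuartic.Divisor f) (c : PlaneQuartic.Form 3)
      (E : PlaneQuartic.Divisor f),
      PlaneQuartic.StepLine P l A → PlaneQuartic.StepCubic Q R A B c E →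
      ∃ (n : PlaneQuartic.Form 2) (D : PlaneQuartic.Divisor f),
        PlaneQuartic.StepConic P B E n D) ∧
    (∀ (l : PlaneQuartic.Form 1) (A : PlaneQuartic.Divisor f) (c : PlaneQuartic.Form 3)
      (E : PlaneQuartic.Divisor f) (n : PlaneQuartic.Form 2) (D : PlaneQuartic.Divisor f),
      PlaneQuartic.StepLine P l A → PlaneQuartic.StepCubic Q R A B c E →
      PlaneQuartic.StepConic P B E n D →
      ∃ S : Fin 3 → PlaneQuartic.Point f, PlaneQuartic.StepOutput D S) ∧
    -- the output of every run is correct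
    (∀ (l : PlaneQuartic.Form 1) (A : PlaneQuartic.Divisor f) (c : PlaneQuartic.Form 3)
      (E : PlaneQuartic.Divisor f) (n : PlaneQuartic.Form 2) (D : PlaneQuartic.Divisor f)
      (S : Fin 3 → PlaneQuartic.Point f),
      PlaneQuartic.StepLine P l A → PlaneQuartic.StepCubic Q R A B c E →
      PlaneQuartic.StepConic P B E n D → PlaneQuartic.StepOutput D S →
      (∃ φ : PlaneQuartic.Fractions f, PlaneQuartic.IsQuotient φ c.1 (l.1 * n.1) ∧
        PlaneQuartic.HasDivisor φ
          (PlaneQuartic.tripleSum Q + PlaneQuartic.tripleSum R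
            - PlaneQuartic.tripleSum P - PlaneQuartic.tripleSum S)) ∧
      PlaneQuartic.LinearlyEquivalent
        (PlaneQuartic.tripleSum S - PlaneQuartic.tripleSum P)
        ((PlaneQuartic.tripleSum Q - PlaneQuartic.tripleSum P)
          + (PlaneQuartic.tripleSum R - PlaneQuartic.tripleSum P)) ∧
      ∀ x y : PlaneQuartic.Jacobian f,
        PlaneQuartic.Represents P Q x → PlaneQuartic.Represents P R y →
          PlaneQuartic.Represents P S (x + y)) := by
  refine ⟨PlaneQuartic.exists_stepLine hf P, fun l A hl => hl.exists_stepCubic hf Q R B,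
    fun l A c E _ hc => hc.exists_stepConic hf P, fun l A c E n D _ _ hn => hn.exists_stepOutput,
    fun l A c E n D S hl hc hn hS => ?_⟩
  have hequiv := PlaneQuartic.linearlyEquivalent_tripleSum_sub hf hl hc hn hS
  exact ⟨PlaneQuartic.exists_isQuotient_hasDivisor hf hl hc hn hS, hequiv,
    fun x y hx hy => hequiv.represents_add hx hy⟩
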